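/- Let $0<\alpha<1$, $\rho>0$, $\mu>0$, and let $\{M(t)\}_{t\ge 0}$ be a Mittag-Leffler Lévy process, i.e. a Lévy process on $[0,\infty)$ with non-decreasing right-continuous paths, $M(0)=0$, and Laplace transform $\mathbb{E}[e^{-uM(t)}]=\left(\frac{\mu}{\mu+u^\alpha}\right)^{\rho t}$ for $u,t\ge 0$. (1) For every $0<l<\alpha/2$ and $t\ge 0$, the moments $\mathbb{E}[M^{l}(t)]$ and $\mathbb{E}[M^{2l}(t)]$ are finite and $$\left(\mathbb{E}[M^{l}(t)]\right)^2\le \mathbb{E}[M^{2l}(t)].$$ (2) Let $0<\beta<\alpha/2$ and $\lambda>0$, and let $\{N_\beta(t,\lambda)\}_{t\ge 0}$ be a fractional Poisson process independent of $\{M(t)\}_{t\ge0}$, i.e. the renewal process $N_\beta(t,\lambda)=\max\{n\ge 0: J_1+\dots+J_n\le t\}$ with i.i.d. waiting times satisfying $\mathbb{P}(J_i>t)=\sum_{k\ge 0}\frac{(-\lambda t^\beta)^k}{\Gamma(\beta k+1)}$ for $t\ge 0$. Let $\mathcal{G}(t)=N_\beta(M(t),\lambda)$ be the generalized fractional negative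 binomial process (GFNBP). Then for every $t\ge0$, $\mathcal{G}(t)$ has a finite second moment and $$\mathrm{Var}[\mathcal{G}(t)]-\mathbb{E}[\mathcal{G}(t)]=\frac{\lambda^2}{\beta}\left(\frac{\mathbb{E}[M^{2\beta}(t)]}{\Gamma(2\beta)}-\frac{\left(\mathbb{E}[M^{\beta}(t)]\right)^2}{\beta\,\Gamma(\beta)^2}\right)\ge 0,$$ with strict inequality $\mathrm{Var}[\mathcal{G}(t)]-\mathbb{E}[\mathcal{G}(t)]>0$ for every $t>0$; that is, the GFNBP is overdispersed. -/

import Mathlib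

open MeasureTheory ProbabilityTheory
open scoped NNReal

noncomputable section

/-- The (one-parameter) Mittag-Leffler function `∑ₖ zᵏ / Γ(β k + 1)`. -/
def mittagLeffler (β z : ℝ) : ℝ :=
  ∑' k : ℕ, z ^ k / Real.Gamma (β * k + 1)

/-- The counting process of the renewal sequence with waiting times `J 0, J 1, …`:
the largest `n` such that `J 0 + ⋯ + J (n - 1) ≤ t`. -/
def renewalCount {Ω : Type*} (J : ℕ → Ω → ℝ) (t : ℝ) (ω : Ω) : ℕ :=
  sSup {n : ℕ | ∑ i ∈ Finset.range n, J i ω ≤ t}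

/-- `N` is a fractional Poisson process of order `β` and intensity `lam`: the renewal process whose
independent waiting times have the Mittag-Leffler law `P(J > t) = E_β(-lam t^β)`, `t ≥ 0`. -/
structure IsFractionalPoissonProcess {Ω : Type*} [MeasurableSpace Ω]
    (β lam : ℝ) (N : ℝ≥0 → Ω → ℕ) (P : Measure Ω) : Prop where
  measurable : ∀ t, Measurable (N t)
  renewal : ∃ J : ℕ → Ω → ℝ,
    (∀ n, Measurable (J n)) ∧
    iIndepFun J P ∧
    (∀ n, ∀ t : ℝ, 0 ≤ t →
      P.real {ω | t < J n ω} = mittagLeffler β (-(lam * t ^ β))) ∧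
    ∀ᵐ ω ∂P, ∀ t : ℝ≥0, N t ω = renewalCount J t ω

/-- `M` is a Mittag-Leffler Lévy process (subordinator) with parameters `α, ρ, μ`: a Lévy process
on `[0, ∞)` with non-decreasing right-continuous paths and Laplace transform
`E[exp (-u M(t))] = (μ / (μ + u^α)) ^ (ρ t)`. -/
structure IsMittagLefflerLevyProcess {Ω : Type*} [MeasurableSpace Ω]
    (α ρ μ : ℝ) (M : ℝ≥0 → Ω → ℝ≥0) (P : Measure Ω) : Prop where
  measurable : ∀ t, Measurable (M t)
  zero : ∀ᵐ ω ∂P, M 0 ω = 0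
  indep_increments : HasIndepIncrements (fun t ω => (M t ω : ℝ)) P
  stationary_increments : ∀ s t : ℝ≥0,
    IdentDistrib (fun ω => (M (s + t) ω : ℝ) - (M s ω : ℝ)) (fun ω => (M t ω : ℝ)) P P
  paths : ∀ᵐ ω ∂P, Monotone (fun t => M t ω) ∧
    ∀ t, ContinuousWithinAt (fun t => M t ω) (Set.Ici t) t
  laplace : ∀ t : ℝ≥0, ∀ u : ℝ, 0 ≤ u →
    ∫ ω, Real.exp (-(u * (M t ω : ℝ))) ∂P = (μ / (μ + u ^ α)) ^ (ρ * (t : ℝ))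

/-- The process `N` time-changed by `M`: `t ↦ N(M(t))`. For `N` a fractional Poisson process and
`M` an independent Mittag-Leffler Lévy process this is the generalized fractional negative binomial
process. -/
def timeChange {Ω : Type*} (N : ℝ≥0 → Ω → ℕ) (M : ℝ≥0 → Ω → ℝ≥0) (t : ℝ≥0) (ω : Ω) : ℕ :=
  N (M t ω) ω

end

/-! Conditioning on the independent clock reduces everything to the moments of N(s): λ s^β/Γ(β+1)
for the first, and 2λ² s^(2β)/Γ(2β+1) plus the first for the second. Replacing s by M(t) and using
Γ(x+1) = xΓ(x) gives the formula. Its sign follows from (E M^β)² ≤ E M^(2β) and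
`Real.Gamma_two_mul_lt`; strictness uses E M^β(t) > 0 for t > 0.

The moments of N(s) are values of weighted renewal functions. With φ(u) = λ/(λ+u^β) the transform of
a waiting time, Σ φ^(n+1) = λ u^(-β) and Σ n φ^(n+1) = λ² u^(-2β), which are transforms of power
densities (`tsum_measure_partialSum_le`). Termwise integration of the Mittag-Leffler series gives φ
only for u^β > λ, so uniqueness is needed from a half-line (`Measure.ext_of_laplace`).

Moments of M(t) of order below α are finite because 1 - E exp(-uM(t)) = O(u^α), which bounds the
tail by a multiple of x^(-α). -/

/-! ### Uniqueness of Laplace transforms -/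

open Complex in
/-- Finite measures on `ℝ` whose moment generating functions are finite and agree near `0`
are equal. -/
lemma Measure.ext_of_mgf_eqOn {μ ν : Measure ℝ} [IsFiniteMeasure μ] [IsFiniteMeasure ν]
    (hμ : ∀ t ∈ Set.Ioo (-1 : ℝ) 1, Integrable (fun x => Real.exp (t * x)) μ)
    (hν : ∀ t ∈ Set.Ioo (-1 : ℝ) 1, Integrable (fun x => Real.exp (t * x)) ν)
    (h : ∀ t ∈ Set.Ioo (-1 : ℝ) 1, mgf id μ t = mgf id ν t) : μ = ν := by
  have hsub : ∀ {ξ : Measure ℝ},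
      (∀ t ∈ Set.Ioo (-1 : ℝ) 1, Integrable (fun x => Real.exp (t * x)) ξ) →
      Set.Ioo (-1 : ℝ) 1 ⊆ interior (integrableExpSet id ξ) := fun hξ =>
    interior_maximal (fun t ht => hξ t ht) isOpen_Ioo
  have hμ' : AnalyticOnNhd ℂ (complexMGF id μ) {z | z.re ∈ Set.Ioo (-1 : ℝ) 1} :=
    analyticOnNhd_complexMGF.mono fun z hz => hsub hμ hz
  have hν' : AnalyticOnNhd ℂ (complexMGF id ν) {z | z.re ∈ Set.Ioo (-1 : ℝ) 1} :=
    analyticOnNhd_complexMGF.mono fun z hz => hsub hν hz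
  have heq : Set.EqOn (complexMGF id μ) (complexMGF id ν) {z | z.re ∈ Set.Ioo (-1 : ℝ) 1} := by
    -- Identity theorem on a vertical strip: the transforms agree at the real points 1/(n+1), which
    -- accumulate at 0. The strip contains the imaginary axis, where they are the characteristic
    -- functions.
    refine AnalyticOnNhd.eqOn_of_preconnected_of_frequently_eq hμ' hν'
      ((convex_Ioo (-1 : ℝ) 1).linear_preimage reLm).isPreconnected (z₀ := 0) (by simp) ?_
    have hev : ∀ᶠ n : ℕ in Filter.atTop, ((1 / ((n : ℝ) + 1) : ℝ)) ∈ Set.Ioo (-1 : ℝ) 1 :=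
      tendsto_one_div_add_atTop_nhds_zero_nat.eventually
        (Ioo_mem_nhds (by norm_num) (by norm_num))
    rw [Filter.frequently_iff_seq_frequently]
    refine ⟨fun n : ℕ => ((1 / ((n : ℝ) + 1) : ℝ) : ℂ), ?_, ?_⟩
    · rw [tendsto_nhdsWithin_iff]
      refine ⟨?_, .of_forall fun n => ?_⟩
      · exact_mod_cast (Complex.continuous_ofReal.tendsto 0).comp
          tendsto_one_div_add_atTop_nhds_zero_nat
      · have : (0 : ℝ) < 1 / ((n : ℝ) + 1) := by positivity
        simpa only [Set.mem_compl_iff, Set.mem_singleton_iff, ofReal_eq_zero] using this.ne'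
    · refine (hev.mono fun n hn => ?_).frequently
      rw [complexMGF_ofReal, complexMGF_ofReal, h _ hn]
  refine Measure.ext_of_charFun (funext fun t => ?_)
  rw [← complexMGF_id_mul_I, ← complexMGF_id_mul_I]
  exact heq (by simp)

/-- Measures on `ℝ` whose Laplace transforms are finite and agree on a half-line are equal. -/
lemma Measure.ext_of_laplace {μ ν : Measure ℝ} (c : ℝ)
    (hfin : ∀ u, c < u → ∫⁻ x, ENNReal.ofReal (Real.exp (-(u * x))) ∂μ ≠ ⊤)
    (h : ∀ u, c < u → ∫⁻ x, ENNReal.ofReal (Real.exp (-(u * x))) ∂μ =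
      ∫⁻ x, ENNReal.ofReal (Real.exp (-(u * x))) ∂ν) : μ = ν := by
  -- Tilting by exp(-(c+1)x) makes the measures finite and turns u = c+1-t > c into t < 1, so the
  -- mgf's exist on (-1, 1). The positive density is divided out at the end.
  set d : ℝ → ENNReal := fun x => ENNReal.ofReal (Real.exp (-((c + 1) * x))) with hd
  have hdm : Measurable d := by fun_prop
  have key : ∀ (ξ : Measure ℝ) (t : ℝ), ∫⁻ x, ENNReal.ofReal (Real.exp (t * x)) ∂(ξ.withDensity d)
      = ∫⁻ x, ENNReal.ofReal (Real.exp (-((c + 1 - t) * x))) ∂ξ := by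
    intro ξ t
    rw [lintegral_withDensity_eq_lintegral_mul _ hdm (by fun_prop)]
    refine lintegral_congr fun x => ?_
    rw [Pi.mul_apply, hd, ← ENNReal.ofReal_mul (Real.exp_pos _).le, ← Real.exp_add]
    ring_nf
  have hint : ∀ ξ : Measure ℝ,
      (∀ u, c < u → ∫⁻ x, ENNReal.ofReal (Real.exp (-(u * x))) ∂ξ ≠ ⊤) →
      ∀ t ∈ Set.Ioo (-1 : ℝ) 1, Integrable (fun x => Real.exp (t * x)) (ξ.withDensity d) := by
    intro ξ hξ t ht
    refine ⟨by fun_prop, ?_⟩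
    rw [hasFiniteIntegral_iff_ofReal (.of_forall fun x => (Real.exp_pos _).le), key]
    exact (hξ _ (by linarith [ht.2])).lt_top
  have hfinite : ∀ ξ : Measure ℝ,
      (∀ u, c < u → ∫⁻ x, ENNReal.ofReal (Real.exp (-(u * x))) ∂ξ ≠ ⊤) →
      IsFiniteMeasure (ξ.withDensity d) := by
    intro ξ hξ
    exact isFiniteMeasure_withDensity (hξ _ (by linarith))
  have hfin' : ∀ u, c < u → ∫⁻ x, ENNReal.ofReal (Real.exp (-(u * x))) ∂ν ≠ ⊤ :=
    fun u hu => h u hu ▸ hfin u hu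
  have := hfinite μ hfin
  have := hfinite ν hfin'
  have heq : μ.withDensity d = ν.withDensity d := by
    refine Measure.ext_of_mgf_eqOn (hint μ hfin) (hint ν hfin') fun t ht => ?_
    simp only [mgf, id]
    rw [integral_eq_lintegral_of_nonneg_ae (.of_forall fun x => (Real.exp_pos _).le) (by fun_prop),
      integral_eq_lintegral_of_nonneg_ae (.of_forall fun x => (Real.exp_pos _).le) (by fun_prop),
      key, key, h _ (by linarith [ht.2])]
  have hinv : ∀ ξ : Measure ℝ, (ξ.withDensity d).withDensity (fun x => (d x)⁻¹) = ξ := fun ξ =>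
    withDensity_inv_same hdm
      (.of_forall fun x => by simp [hd, Real.exp_pos]) (.of_forall fun x => ENNReal.ofReal_ne_top)
  rw [← hinv μ, heq, hinv]

/-! ### Laplace transform of the waiting times -/

/-- The Laplace transform at `u` of the Mittag-Leffler survival function, for large `u`. -/
lemma integral_mittagLeffler_mul_exp {β lam u : ℝ} (hβ : 0 < β) (hlam : 0 < lam) (hu : 0 < u)
    (hul : lam < u ^ β) :
    ∫ t in Set.Ioi (0 : ℝ), mittagLeffler β (-(lam * t ^ β)) * (u * Real.exp (-(u * t))) =
      u ^ β / (lam + u ^ β) := by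
  have hup : 0 < u ^ β := by positivity
  set F : ℕ → ℝ → ℝ := fun k t =>
    ((-(lam * t ^ β)) ^ k / Real.Gamma (β * k + 1)) * (u * Real.exp (-(u * t))) with hF
  have hG : ∀ k : ℕ, 0 < Real.Gamma (β * k + 1) := fun k => Real.Gamma_pos_of_pos (by positivity)
  have hexp : ∀ k : ℕ, ∀ t ∈ Set.Ioi (0 : ℝ), F k t =
      ((-lam) ^ k * u / Real.Gamma (β * k + 1)) *
        (t ^ ((β * k + 1) - 1) * Real.exp (-(u * t))) := by
    intro k t ht
    simp only [hF]
    rw [show β * (k : ℝ) + 1 - 1 = β * k by ring, Real.rpow_mul (le_of_lt ht), Real.rpow_natCast,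
      ← neg_mul, mul_pow]
    ring
  have hint0 : ∀ k : ℕ, IntegrableOn
      (fun t : ℝ => t ^ ((β * k + 1) - 1) * Real.exp (-(u * t))) (Set.Ioi 0) := by
    intro k
    -- A non-integrable function has integral 0 by convention, but the Gamma formula gives a
    -- positive value.
    by_contra hcon
    have h1 := Real.integral_rpow_mul_exp_neg_mul_Ioi (a := β * k + 1) (r := u)
      (by positivity) hu
    rw [integral_undef hcon] at h1
    have : 0 < (1 / u) ^ (β * (k : ℝ) + 1) * Real.Gamma (β * k + 1) := by
      have := hG k
      positivity
    exact this.ne h1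
  have hint : ∀ k, IntegrableOn (F k) (Set.Ioi 0) := fun k =>
    IntegrableOn.congr_fun ((hint0 k).const_mul _) (fun t ht => (hexp k t ht).symm)
      measurableSet_Ioi
  have hpw : ∀ k : ℕ, u * (1 / u) ^ (β * (k : ℝ) + 1) = ((u ^ β)⁻¹) ^ k := by
    intro k
    rw [Real.rpow_add (by positivity), Real.rpow_one, Real.rpow_mul (by positivity),
      Real.rpow_natCast, one_div, Real.inv_rpow hu.le]
    field_simp
  have hval : ∀ k, ∫ t in Set.Ioi (0 : ℝ), F k t = (-(lam / u ^ β)) ^ k := by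
    intro k
    rw [setIntegral_congr_fun measurableSet_Ioi (hexp k), integral_const_mul,
      Real.integral_rpow_mul_exp_neg_mul_Ioi (by positivity) hu]
    have h2 := (hG k).ne'
    rw [div_eq_mul_inv lam, ← neg_mul, mul_pow, ← hpw]
    field_simp
  have hnorm : ∀ k, ∫ t in Set.Ioi (0 : ℝ), ‖F k t‖ = (lam / u ^ β) ^ k := by
    intro k
    have : ∀ t ∈ Set.Ioi (0 : ℝ), ‖F k t‖ = (lam ^ k * u / Real.Gamma (β * k + 1)) *
        (t ^ ((β * k + 1) - 1) * Real.exp (-(u * t))) := by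
      intro t ht
      have ht' : (0 : ℝ) < t := ht
      rw [hexp k t ht]
      simp [abs_of_pos, hlam, hu, hG k, Real.rpow_pos_of_pos ht']
    rw [setIntegral_congr_fun measurableSet_Ioi this, integral_const_mul,
      Real.integral_rpow_mul_exp_neg_mul_Ioi (by positivity) hu]
    have h2 := (hG k).ne'
    rw [div_eq_mul_inv lam, mul_pow, ← hpw]
    field_simp
  have hr : lam / u ^ β < 1 := (div_lt_one hup).2 hul
  have hsum : Summable fun k => ∫ t in Set.Ioi (0 : ℝ), ‖F k t‖ := by
    simp_rw [hnorm]
    exact summable_geometric_of_lt_one (by positivity) hr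
  have h1 := hasSum_integral_of_summable_integral_norm hint hsum
  simp_rw [hval] at h1
  have h2 := hasSum_geometric_of_norm_lt_one (ξ := -(lam / u ^ β))
    (by rw [norm_neg, Real.norm_of_nonneg (by positivity)]; exact hr)
  have h3 := h1.unique h2
  simp only [mittagLeffler]
  simp_rw [← tsum_mul_right]
  rw [h3, sub_neg_eq_add]
  field_simp
  ring

/-- The Laplace transform of the Mittag-Leffler law, for large arguments. -/
lemma laplace_of_mittagLeffler {Ω : Type*} [MeasurableSpace Ω] {P : Measure Ω}
    [IsProbabilityMeasure P] {β lam u : ℝ} (hβ : 0 < β) (hlam : 0 < lam) (hu : 0 < u)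
    (hul : lam < u ^ β) {X : Ω → ℝ} (hX : Measurable X) (hX0 : ∀ᵐ ω ∂P, 0 ≤ X ω)
    (hlaw : ∀ t : ℝ, 0 ≤ t → P.real {ω | t < X ω} = mittagLeffler β (-(lam * t ^ β))) :
    mgf X P (-u) = lam / (lam + u ^ β) := by
  have hup : 0 < u ^ β := by positivity
  -- Layer cake with weight u exp(-ut), whose primitive is 1 - exp(-ux): this expresses 1 - E
  -- exp(-uX) through the survival function.
  have hlc := lintegral_comp_eq_lintegral_meas_lt_mul P hX0 hX.aemeasurable
    (g := fun t => u * Real.exp (-(u * t)))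
    (fun t _ => (by fun_prop : Continuous fun t => u * Real.exp (-(u * t))).intervalIntegrable _ _)
    (.of_forall fun t => by positivity)
  have hprim : ∀ x : ℝ, ∫ t in (0 : ℝ)..x, u * Real.exp (-(u * t)) = 1 - Real.exp (-(u * x)) := by
    intro x
    rw [intervalIntegral.integral_eq_sub_of_hasDerivAt
      (f := fun t => -Real.exp (-(u * t)))]
    · simp; ring
    · intro t _
      have := ((((hasDerivAt_id t).const_mul u).neg).exp).neg
      convert! this using 1
      simp; ring
    · exact (by fun_prop : Continuous fun t => u * Real.exp (-(u * t))).intervalIntegrable _ _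
  have hI := integral_mittagLeffler_mul_exp hβ hlam hu hul
  have hintg : IntegrableOn
      (fun t => mittagLeffler β (-(lam * t ^ β)) * (u * Real.exp (-(u * t)))) (Set.Ioi 0) := by
    by_contra hcon
    rw [integral_undef hcon] at hI
    have : 0 < u ^ β / (lam + u ^ β) := by positivity
    exact this.ne hI
  have hright : ∫⁻ t in Set.Ioi (0 : ℝ), P {ω | t < X ω} *
      ENNReal.ofReal (u * Real.exp (-(u * t))) = ENNReal.ofReal (u ^ β / (lam + u ^ β)) := by
    rw [← hI, ofReal_integral_eq_lintegral_ofReal hintg]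
    · refine setLIntegral_congr_fun measurableSet_Ioi fun t ht => ?_
      rw [← hlaw t (le_of_lt ht), ENNReal.ofReal_mul measureReal_nonneg,
        ofReal_measureReal]
    · refine (ae_restrict_iff' measurableSet_Ioi).2 (.of_forall fun t ht => ?_)
      change 0 ≤ mittagLeffler β (-(lam * t ^ β)) * (u * Real.exp (-(u * t)))
      rw [← hlaw t (le_of_lt ht)]
      positivity
  have hexpint : Integrable (fun ω => Real.exp (-(u * X ω))) P := by
    refine Integrable.of_bound (by fun_prop) 1 (hX0.mono fun ω hω => ?_)
    rw [Real.norm_of_nonneg (Real.exp_pos _).le, Real.exp_le_one_iff]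
    have : 0 ≤ u * X ω := by positivity
    linarith
  have hleft : ∫⁻ ω, ENNReal.ofReal (∫ t in (0 : ℝ)..X ω, u * Real.exp (-(u * t))) ∂P =
      ENNReal.ofReal (1 - mgf X P (-u)) := by
    simp_rw [hprim]
    rw [← ofReal_integral_eq_lintegral_ofReal
      (f := fun ω => 1 - Real.exp (-(u * X ω))) ((integrable_const 1).sub hexpint)]
    · rw [integral_sub (integrable_const 1) hexpint]
      simp [mgf]
    · filter_upwards [hX0] with ω hω
      have : 0 ≤ u * X ω := by positivity
      simp [this]
  rw [hleft, hright, ENNReal.ofReal_eq_ofReal_iff] at hlc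
  · have : lam / (lam + u ^ β) = 1 - u ^ β / (lam + u ^ β) := by field_simp; ring
    linarith
  · rw [sub_nonneg]
    have h1 : mgf X P (-u) ≤ ∫ ω, (1 : ℝ) ∂P := by
      refine integral_mono_ae (by simpa [mgf] using hexpint) (integrable_const 1) ?_
      filter_upwards [hX0] with ω hω
      have : 0 ≤ u * X ω := by positivity
      simpa using this
    simpa using h1
  · positivity

/-! ### Weighted renewal measures -/

/-- A measure with density `C / Γ(b) x ^ (b - 1)` on `(0, ∞)`. -/
noncomputable def powerMeasure (C b : ℝ) : Measure ℝ :=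
  (volume.restrict (Set.Ioi 0)).withDensity
    fun x => ENNReal.ofReal (C / Real.Gamma b * x ^ (b - 1))

lemma laplace_powerMeasure {C b u : ℝ} (hC : 0 ≤ C) (hb : 0 < b) (hu : 0 < u) :
    ∫⁻ x, ENNReal.ofReal (Real.exp (-(u * x))) ∂(powerMeasure C b) =
      ENNReal.ofReal (C * u ^ (-b)) := by
  have hG := Real.Gamma_pos_of_pos hb
  have hI := Real.integral_rpow_mul_exp_neg_mul_Ioi hb hu
  have hint : IntegrableOn (fun t : ℝ => t ^ (b - 1) * Real.exp (-(u * t))) (Set.Ioi 0) := by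
    by_contra hcon
    rw [integral_undef hcon] at hI
    have : 0 < (1 / u) ^ b * Real.Gamma b := by positivity
    exact this.ne hI
  have hval : C * u ^ (-b) = ∫ t in Set.Ioi (0 : ℝ),
      C / Real.Gamma b * (t ^ (b - 1) * Real.exp (-(u * t))) := by
    rw [integral_const_mul, hI, one_div, Real.inv_rpow hu.le, Real.rpow_neg hu.le]
    field_simp
  rw [powerMeasure, lintegral_withDensity_eq_lintegral_mul _ (by fun_prop) (by fun_prop), hval,
    ofReal_integral_eq_lintegral_ofReal (hint.const_mul _)]
  · refine setLIntegral_congr_fun measurableSet_Ioi fun t ht => ?_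
    have ht' : (0 : ℝ) < t := ht
    rw [Pi.mul_apply, ← ENNReal.ofReal_mul (by positivity), mul_assoc]
  · refine (ae_restrict_iff' measurableSet_Ioi).2 (.of_forall fun t ht => ?_)
    have ht' : (0 : ℝ) < t := ht
    simp only [Pi.zero_apply]
    positivity

lemma powerMeasure_Iic {C b s : ℝ} (hC : 0 ≤ C) (hb : 0 < b) (hs : 0 ≤ s) :
    powerMeasure C b (Set.Iic s) = ENNReal.ofReal (C * s ^ b / Real.Gamma (b + 1)) := by
  have hG := Real.Gamma_pos_of_pos hb
  rw [powerMeasure, withDensity_apply _ measurableSet_Iic,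
    Measure.restrict_restrict measurableSet_Iic, Set.inter_comm, Set.Ioi_inter_Iic,
    ← ofReal_integral_eq_lintegral_ofReal, ← intervalIntegral.integral_of_le hs,
    intervalIntegral.integral_const_mul, integral_rpow (.inl (by linarith)),
    Real.Gamma_add_one hb.ne']
  · simp only [sub_add_cancel, Real.zero_rpow hb.ne', sub_zero]
    congr 1
    field_simp
  · rw [← IntegrableOn, ← intervalIntegrable_iff_integrableOn_Ioc_of_le hs]
    exact (intervalIntegral.intervalIntegrable_rpow' (by linarith)).const_mul _
  · refine (ae_restrict_iff' measurableSet_Ioc).2 (.of_forall fun t ht => ?_)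
    have ht' : (0 : ℝ) < t := ht.1
    simp only [Pi.zero_apply]
    positivity

/-- A weighted renewal function is identified by its Laplace–Stieltjes transform. -/
lemma tsum_measure_partialSum_le {Ω : Type*} [MeasurableSpace Ω] {P : Measure Ω}
    [IsProbabilityMeasure P] {J : ℕ → Ω → ℝ} (hJ : ∀ n, Measurable (J n)) (hind : iIndepFun J P)
    (hJ0 : ∀ᵐ ω ∂P, ∀ n, 0 ≤ J n ω) {c : ℝ} (hc : 0 ≤ c) {φ : ℝ → ℝ}
    (hφ : ∀ n u, c < u → mgf (J n) P (-u) = φ u) {w : ℕ → ℝ} (hw : ∀ n, 0 ≤ w n) {C b : ℝ}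
    (hC : 0 ≤ C) (hb : 0 < b)
    (hsum : ∀ u, c < u → HasSum (fun n => w n * φ u ^ (n + 1)) (C * u ^ (-b)))
    {s : ℝ} (hs : 0 ≤ s) :
    ∑' n, ENNReal.ofReal (w n) * P {ω | ∑ i ∈ Finset.range (n + 1), J i ω ≤ s} =
      ENNReal.ofReal (C * s ^ b / Real.Gamma (b + 1)) := by
  have hSm : ∀ n, Measurable fun ω => ∑ i ∈ Finset.range (n + 1), J i ω := fun n => by fun_prop
  set U : Measure ℝ := Measure.sum fun n =>
    ENNReal.ofReal (w n) • P.map fun ω => ∑ i ∈ Finset.range (n + 1), J i ω with hU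
  have hlap : ∀ u, c < u → ∫⁻ x, ENNReal.ofReal (Real.exp (-(u * x))) ∂U =
      ENNReal.ofReal (C * u ^ (-b)) := by
    intro u hu
    have hu0 : 0 < u := hc.trans_lt hu
    have hφ0 : 0 ≤ φ u := by rw [← hφ 0 u hu]; exact mgf_nonneg
    rw [hU, lintegral_sum_measure, ← (hsum u hu).tsum_eq,
      ENNReal.ofReal_tsum_of_nonneg (fun n => mul_nonneg (hw n) (pow_nonneg hφ0 _))
        (hsum u hu).summable]
    refine tsum_congr fun n => ?_
    rw [lintegral_smul_measure, lintegral_map (by fun_prop) (hSm n), smul_eq_mul,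
      ENNReal.ofReal_mul (hw n)]
    congr 1
    have hmgf := hind.mgf_sum hJ (t := -u) (Finset.range (n + 1))
    rw [Finset.prod_congr rfl fun i _ => hφ i u hu, Finset.prod_const, Finset.card_range] at hmgf
    rw [← hmgf, mgf, ofReal_integral_eq_lintegral_ofReal]
    · simp
    · refine Integrable.of_bound (by fun_prop) 1 (hJ0.mono fun ω hω => ?_)
      rw [Real.norm_of_nonneg (Real.exp_pos _).le, Real.exp_le_one_iff, Finset.sum_apply]
      have : 0 ≤ u * ∑ i ∈ Finset.range (n + 1), J i ω :=
        mul_nonneg hu0.le (Finset.sum_nonneg fun i _ => hω i)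
      linarith
    · exact .of_forall fun ω => (Real.exp_pos _).le
  have hUV : U = powerMeasure C b := by
    refine Measure.ext_of_laplace c (fun u hu => ?_) (fun u hu => ?_)
    · rw [hlap u hu]; exact ENNReal.ofReal_ne_top
    · rw [hlap u hu, laplace_powerMeasure hC hb (hc.trans_lt hu)]
  rw [← powerMeasure_Iic hC hb hs, ← hUV, hU, Measure.sum_apply _ measurableSet_Iic]
  refine tsum_congr fun n => ?_
  rw [Measure.smul_apply, Measure.map_apply (hSm n) measurableSet_Iic, smul_eq_mul]
  rfl

/-! ### Renewal paths and their counts -/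

/-- A sequence of nonnegative waiting times with only finitely many renewals in bounded time. -/
structure IsRenewalPath (x : ℕ → ℝ) : Prop where
  nonneg : ∀ n, 0 ≤ x n
  finite : ∀ s : ℝ, ∃ n, s < ∑ i ∈ Finset.range (n + 1), x i

/-- Partial sums increase and eventually exceed s, so the set is bounded and its `sSup` is a true
maximum; the empty sum makes it nonempty. -/
lemma IsRenewalPath.lt_count_iff {x : ℕ → ℝ} (hx : IsRenewalPath x) {s : ℝ} (hs : 0 ≤ s) (n : ℕ) :
    n < sSup {n : ℕ | ∑ i ∈ Finset.range n, x i ≤ s} ↔ ∑ i ∈ Finset.range (n + 1), x i ≤ s := by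
  have hmono : Monotone fun n => ∑ i ∈ Finset.range n, x i :=
    monotone_nat_of_le_succ fun n => by
      rw [Finset.sum_range_succ]; linarith [hx.nonneg n]
  set A := {n : ℕ | ∑ i ∈ Finset.range n, x i ≤ s} with hA
  have hbdd : BddAbove A := by
    obtain ⟨k, hk⟩ := hx.finite s
    refine ⟨k + 1, fun n hn => ?_⟩
    by_contra! hlt
    exact absurd (hk.trans_le (hmono hlt.le)) (not_lt.2 hn)
  have hne : A.Nonempty := ⟨0, by simpa [hA] using hs⟩
  constructor
  · intro h
    exact (hmono (Nat.succ_le_of_lt h)).trans (Nat.sSup_mem hne hbdd)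
  · intro h
    exact Nat.lt_of_succ_le (le_csSup hbdd h)

lemma tsum_ite_lt_eq_sum_range (w : ℕ → ENNReal) (N : ℕ) :
    ∑' n, (if n < N then w n else 0) = ∑ n ∈ Finset.range N, w n := by
  rw [tsum_eq_sum (s := Finset.range N) (fun n hn => if_neg (by simpa using hn))]
  exact Finset.sum_congr rfl fun n hn => if_pos (Finset.mem_range.1 hn)

/-- Tonelli applied to indicators of {n < N}. Weight 1 yields E N, and weight n yields E N(N-1)/2.
-/
lemma lintegral_sum_range_count {Ω : Type*} [MeasurableSpace Ω] {P : Measure Ω}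
    {J : ℕ → Ω → ℝ} (hJ : ∀ n, Measurable (J n)) {s : ℝ} {N : Ω → ℕ}
    (hN : ∀ᵐ ω ∂P, ∀ n, n < N ω ↔ ∑ i ∈ Finset.range (n + 1), J i ω ≤ s) (w : ℕ → ENNReal) :
    ∫⁻ ω, ∑ n ∈ Finset.range (N ω), w n ∂P =
      ∑' n, w n * P {ω | ∑ i ∈ Finset.range (n + 1), J i ω ≤ s} := by
  have hms : ∀ n, MeasurableSet {ω | ∑ i ∈ Finset.range (n + 1), J i ω ≤ s} := fun n =>
    measurableSet_le (by fun_prop) measurable_const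
  have h1 : ∫⁻ ω, ∑ n ∈ Finset.range (N ω), w n ∂P = ∫⁻ ω, ∑' n,
      {ω | ∑ i ∈ Finset.range (n + 1), J i ω ≤ s}.indicator (fun _ => w n) ω ∂P := by
    refine lintegral_congr_ae (hN.mono fun ω hω => ?_)
    simp only
    rw [← tsum_ite_lt_eq_sum_range]
    refine tsum_congr fun n => ?_
    simp only [Set.indicator_apply, Set.mem_ofPred_eq, ← hω n]
  rw [h1, lintegral_tsum fun n => (measurable_const.indicator (hms n)).aemeasurable]
  refine tsum_congr fun n => ?_
  rw [lintegral_indicator_const (hms n)]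

/-! ### Renewal functions of the fractional Poisson process -/

namespace IsFractionalPoissonProcess

variable {Ω : Type*} [MeasurableSpace Ω] {P : Measure Ω} [IsProbabilityMeasure P] {β lam : ℝ}
  {N : ℝ≥0 → Ω → ℕ}

/-- The renewal structure of a fractional Poisson process, with its first two weighted renewal
functions. -/
lemma exists_renewal (hβ : 0 < β) (hlam : 0 < lam)
    (hN : IsFractionalPoissonProcess β lam N P) :
    ∃ J : ℕ → Ω → ℝ, (∀ n, Measurable (J n)) ∧ (∀ᵐ ω ∂P, IsRenewalPath fun n => J n ω) ∧
      (∀ᵐ ω ∂P, ∀ t : ℝ≥0, N t ω = renewalCount J t ω) ∧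
      (∀ s : ℝ, 0 ≤ s → ∑' n, P {ω | ∑ i ∈ Finset.range (n + 1), J i ω ≤ s} =
        ENNReal.ofReal (lam * s ^ β / Real.Gamma (β + 1))) ∧
      (∀ s : ℝ, 0 ≤ s →
        ∑' n : ℕ, (n : ENNReal) * P {ω | ∑ i ∈ Finset.range (n + 1), J i ω ≤ s} =
          ENNReal.ofReal (lam ^ 2 * s ^ (2 * β) / Real.Gamma (2 * β + 1))) := by
  obtain ⟨J, hJ, hind, hlaw, hcount⟩ := hN.renewal
  have hJ0 : ∀ᵐ ω ∂P, ∀ n, 0 ≤ J n ω := by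
    refine ae_all_iff.2 fun n => ?_
    -- Positivity of the waiting times is not assumed; it comes from the law at t = 0, where the
    -- series equals 1.
    have h0 := hlaw n 0 le_rfl
    have h1 : mittagLeffler β (-(lam * 0 ^ β)) = 1 := by
      rw [Real.zero_rpow hβ.ne', mul_zero, neg_zero, mittagLeffler,
        tsum_eq_single 0 (fun k hk => by simp [hk])]
      simp
    rw [h1, measureReal_def, ENNReal.toReal_eq_one_iff] at h0
    have h2 : ∀ᵐ ω ∂P, ω ∈ {ω | 0 < J n ω} :=
      (mem_ae_iff_prob_eq_one (measurableSet_lt measurable_const (hJ n))).2 h0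
    exact h2.mono fun ω hω => le_of_lt hω
  set c : ℝ := lam ^ β⁻¹ with hc
  have hc0 : 0 < c := Real.rpow_pos_of_pos hlam _
  have hcu : ∀ u, c < u → lam < u ^ β := by
    intro u hu
    have := Real.rpow_lt_rpow hc0.le hu hβ
    rwa [hc, Real.rpow_inv_rpow hlam.le hβ.ne'] at this
  have hφ : ∀ n u, c < u → mgf (J n) P (-u) = lam / (lam + u ^ β) := fun n u hu =>
    laplace_of_mittagLeffler hβ hlam (hc0.trans hu) (hcu u hu) (hJ n)
      (hJ0.mono fun ω hω => hω n) (hlaw n)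
  have hr : ∀ u, c < u → ‖lam / (lam + u ^ β)‖ < 1 := by
    intro u hu
    have : 0 < u ^ β := hlam.trans (hcu u hu)
    rw [Real.norm_of_nonneg (by positivity), div_lt_one (by positivity)]
    linarith
  have hren1 : ∀ s : ℝ, 0 ≤ s → ∑' n, P {ω | ∑ i ∈ Finset.range (n + 1), J i ω ≤ s} =
        ENNReal.ofReal (lam * s ^ β / Real.Gamma (β + 1)) := by
    intro s hs
    rw [← tsum_measure_partialSum_le hJ hind hJ0 hc0.le hφ (w := fun _ => 1) (by simp) hlam.le hβ
      ?_ hs]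
    · simp
    · intro u hu
      have hu0 : 0 < u := hc0.trans hu
      have : 0 < u ^ β := hlam.trans (hcu u hu)
      convert! (hasSum_geometric_of_norm_lt_one (hr u hu)).mul_right (lam / (lam + u ^ β)) using 1
      · ext n; ring
      · rw [Real.rpow_neg hu0.le]
        have : lam + u ^ β - lam ≠ 0 := by linarith
        field_simp
        ring
  refine ⟨J, hJ, ?_, hcount, hren1, ?_⟩
  -- Borel–Cantelli: the finite renewal function rules out infinitely many renewals before any
  -- integer time.
  · have hfin : ∀ᵐ ω ∂P, ∀ k : ℕ, ∀ᶠ n in Filter.atTop,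
        ω ∉ {ω | ∑ i ∈ Finset.range (n + 1), J i ω ≤ k} := by
      refine ae_all_iff.2 fun k => ae_eventually_notMem ?_
      rw [hren1 k (by positivity)]
      exact ENNReal.ofReal_ne_top
    filter_upwards [hJ0, hfin] with ω h0 hω
    refine ⟨h0, fun s => ?_⟩
    obtain ⟨k, hk⟩ := exists_nat_ge s
    obtain ⟨n, hn⟩ := (hω k).exists
    exact ⟨n, hk.trans_lt (not_le.1 hn)⟩
  · intro s hs
    rw [← tsum_measure_partialSum_le hJ hind hJ0 hc0.le hφ (w := fun n => (n : ℝ)) (by simp)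
      (by positivity) (by positivity : 0 < 2 * β) ?_ hs]
    · simp
    · intro u hu
      have hu0 : 0 < u := hc0.trans hu
      have : 0 < u ^ β := hlam.trans (hcu u hu)
      convert! (hasSum_coe_mul_geometric_of_norm_lt_one (hr u hu)).mul_right
        (lam / (lam + u ^ β)) using 1
      · ext n; ring
      · rw [mul_comm 2 β, Real.rpow_neg hu0.le, Real.rpow_mul hu0.le, Real.rpow_two]
        have h1 : 1 - lam / (lam + u ^ β) = u ^ β / (lam + u ^ β) := by
          field_simp; ring
        rw [h1]
        field_simp

end IsFractionalPoissonProcess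

lemma natCast_sq_eq_sum_range (N : ℕ) :
    (N : ENNReal) ^ 2 = 2 * ∑ n ∈ Finset.range N, (n : ENNReal) + N := by
  have h : N ^ 2 = 2 * ∑ n ∈ Finset.range N, n + N := by
    rw [mul_comm, Finset.sum_range_id_mul_two]
    cases N with
    | zero => simp
    | succ k => simp; ring
  have h' := congrArg (Nat.cast : ℕ → ENNReal) h
  push_cast at h' ⊢
  exact h'

/-! ### Joint measurability of path and time -/

/-- The value at `m` of a right-continuous non-decreasing path `n`, as a measurable function of the
path and of `m`. -/
noncomputable def evalRight (p : (ℝ≥0 → ℕ) × ℝ≥0) : ENNReal :=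
  ⨅ q : ℕ × ℕ, if p.2 < (q.1 : ℝ≥0) / ((q.2 : ℝ≥0) + 1) then
    (p.1 ((q.1 : ℝ≥0) / ((q.2 : ℝ≥0) + 1)) : ENNReal) else ⊤

/-- Evaluating a path at a random time is not measurable on the full product space; an infimum over
countably many rational times is. -/
lemma measurable_evalRight : Measurable evalRight := by
  refine Measurable.iInf fun q => Measurable.ite ?_ ?_ measurable_const
  · exact measurableSet_lt measurable_snd measurable_const
  · exact (Measurable.of_discrete (f := fun n : ℕ => (n : ENNReal))).comp
      ((measurable_pi_apply _).comp measurable_fst)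

lemma exists_div_between (a b : ℝ≥0) (hab : a < b) :
    ∃ q : ℕ × ℕ, a < (q.1 : ℝ≥0) / ((q.2 : ℝ≥0) + 1) ∧ (q.1 : ℝ≥0) / ((q.2 : ℝ≥0) + 1) < b := by
  obtain ⟨r, har, hrb⟩ := exists_rat_btwn (NNReal.coe_lt_coe.2 hab)
  have hr : (0 : ℚ) < r := by exact_mod_cast (a.coe_nonneg.trans_lt har)
  have hcast : (((r.num.toNat : ℝ≥0) / (((r.den - 1 : ℕ) : ℝ≥0) + 1) : ℝ≥0) : ℝ) = (r : ℝ) := by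
    have h1 : ((r.den - 1 : ℕ) : ℝ) + 1 = r.den := by
      exact_mod_cast Nat.sub_add_cancel r.pos
    have h2 : ((r.num.toNat : ℕ) : ℝ) = (r.num : ℝ) := by
      exact_mod_cast Int.toNat_of_nonneg (Rat.num_pos.2 hr).le
    simp only [NNReal.coe_div, NNReal.coe_add, NNReal.coe_natCast, NNReal.coe_one]
    rw [h1, h2]
    exact_mod_cast Rat.num_div_den r
  refine ⟨(r.num.toNat, r.den - 1), ?_, ?_⟩
  · rw [← NNReal.coe_lt_coe, hcast]; exact har
  · rw [← NNReal.coe_lt_coe, hcast]; exact hrb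

/-- Some rational lies between m and the next renewal epoch, and there the count is still n m;
monotonicity gives the other inequality. -/
lemma evalRight_eq {x : ℕ → ℝ} (hx : IsRenewalPath x) {n : ℝ≥0 → ℕ}
    (hn : ∀ t : ℝ≥0, n t = sSup {k : ℕ | ∑ i ∈ Finset.range k, x i ≤ t}) (m : ℝ≥0) :
    evalRight (n, m) = n m := by
  have hlt : ∀ t k, k < n t ↔ ∑ i ∈ Finset.range (k + 1), x i ≤ t := fun t k => by
    rw [hn]; exact hx.lt_count_iff t.coe_nonneg k
  have hmono : Monotone n := by
    intro s t hst
    by_contra! h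
    exact lt_irrefl _ ((hlt t _).2 (((hlt s _).1 h).trans (NNReal.coe_le_coe.2 hst)))
  refine le_antisymm ?_ (le_iInf fun q => ?_)
  · have h1 : (m : ℝ) < ∑ i ∈ Finset.range (n m + 1), x i :=
      not_le.1 fun h => lt_irrefl _ ((hlt m _).2 h)
    obtain ⟨q, hq1, hq2⟩ := exists_div_between m
      ⟨∑ i ∈ Finset.range (n m + 1), x i, m.coe_nonneg.trans h1.le⟩ h1
    refine (iInf_le _ q).trans ?_
    simp only [hq1, if_true]
    refine Nat.cast_le.2 ?_
    by_contra! h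
    exact absurd ((hlt _ _).1 h) (not_le.2 hq2)
  · simp only
    split_ifs with h
    · exact Nat.cast_le.2 (hmono h.le)
    · exact le_top

/-! ### Conditioning on the clock -/

namespace IsFractionalPoissonProcess

variable {Ω : Type*} [MeasurableSpace Ω] {P : Measure Ω} [IsProbabilityMeasure P] {β lam : ℝ}
  {N : ℝ≥0 → Ω → ℕ}

lemma lintegral_moments (hβ : 0 < β) (hlam : 0 < lam)
    (hN : IsFractionalPoissonProcess β lam N P) (s : ℝ≥0) :
    ∫⁻ ω, (N s ω : ENNReal) ∂P = ENNReal.ofReal (lam * (s : ℝ) ^ β / Real.Gamma (β + 1)) ∧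
    ∫⁻ ω, (N s ω : ENNReal) ^ 2 ∂P =
      ENNReal.ofReal (2 * (lam ^ 2 * (s : ℝ) ^ (2 * β) / Real.Gamma (2 * β + 1)) +
        lam * (s : ℝ) ^ β / Real.Gamma (β + 1)) := by
  obtain ⟨J, hJ, hpath, hcount, h1, h2⟩ := hN.exists_renewal hβ hlam
  have hNs : ∀ᵐ ω ∂P, ∀ n, n < N s ω ↔ ∑ i ∈ Finset.range (n + 1), J i ω ≤ s := by
    filter_upwards [hpath, hcount] with ω hω hc n
    rw [hc]
    exact hω.lt_count_iff s.coe_nonneg n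
  have e1 := lintegral_sum_range_count hJ hNs fun _ => 1
  have e2 := lintegral_sum_range_count hJ hNs fun n => (n : ENNReal)
  simp only [Finset.sum_const, Finset.card_range, nsmul_eq_mul, mul_one, one_mul] at e1
  rw [h1 s s.coe_nonneg] at e1
  rw [h2 s s.coe_nonneg] at e2
  have hG1 : 0 < Real.Gamma (β + 1) := Real.Gamma_pos_of_pos (by positivity)
  have hG2 : 0 < Real.Gamma (2 * β + 1) := Real.Gamma_pos_of_pos (by positivity)
  have hmeas : Measurable fun ω => (N s ω : ENNReal) :=
    (Measurable.of_discrete (f := fun n : ℕ => (n : ENNReal))).comp (hN.measurable s)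
  refine ⟨e1, ?_⟩
  simp_rw [natCast_sq_eq_sum_range]
  rw [lintegral_add_right _ hmeas, lintegral_const_mul' _ _ (by simp), e1, e2,
    ENNReal.ofReal_add (by positivity) (by positivity), ENNReal.ofReal_mul (by norm_num)]
  simp

lemma ae_evalRight_eq (hβ : 0 < β) (hlam : 0 < lam)
    (hN : IsFractionalPoissonProcess β lam N P) :
    ∀ᵐ ω ∂P, ∀ m : ℝ≥0, evalRight (fun t => N t ω, m) = N m ω := by
  obtain ⟨J, hJ, hpath, hcount, -, -⟩ := hN.exists_renewal hβ hlam
  filter_upwards [hpath, hcount] with ω hω hc m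
  exact evalRight_eq hω hc m

/-- By independence the joint law of the path N and the time M(t) is a product; `evalRight` supplies
the measurable integrand Tonelli needs. -/
lemma lintegral_timeChange (hβ : 0 < β) (hlam : 0 < lam)
    (hN : IsFractionalPoissonProcess β lam N P) {M : ℝ≥0 → Ω → ℝ≥0} (hM : ∀ t, Measurable (M t))
    (hind : IndepFun (fun ω t => N t ω) (fun ω t => M t ω) P) (t : ℝ≥0)
    {F : ENNReal → ENNReal} (hF : Measurable F) :
    ∫⁻ ω, F (timeChange N M t ω) ∂P = ∫⁻ ω, ∫⁻ ω', F (N (M t ω) ω') ∂P ∂P := by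
  have hae := hN.ae_evalRight_eq hβ hlam
  have hNm : Measurable fun ω t => N t ω := measurable_pi_lambda _ hN.measurable
  have hind' : IndepFun (fun ω t => N t ω) (M t) P :=
    hind.comp (φ := id) (ψ := fun m : ℝ≥0 → ℝ≥0 => m t) measurable_id (measurable_pi_apply t)
  have hFe : Measurable fun p => F (evalRight p) := hF.comp measurable_evalRight
  calc ∫⁻ ω, F (timeChange N M t ω) ∂P
      = ∫⁻ ω, F (evalRight (fun s => N s ω, M t ω)) ∂P :=
        lintegral_congr_ae (hae.mono fun ω hω => by simp only [hω, timeChange])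
    _ = ∫⁻ p, F (evalRight p) ∂(P.map fun ω => (fun s => N s ω, M t ω)) :=
        (lintegral_map hFe (hNm.prodMk (hM t))).symm
    _ = ∫⁻ m, ∫⁻ n, F (evalRight (n, m)) ∂(P.map fun ω s => N s ω) ∂(P.map (M t)) := by
        have := Measure.isProbabilityMeasure_map (μ := P) hNm.aemeasurable
        have := Measure.isProbabilityMeasure_map (μ := P) (hM t).aemeasurable
        rw [(indepFun_iff_map_prod_eq_prod_map_map hNm.aemeasurable (hM t).aemeasurable).1 hind',
          lintegral_prod_symm _ hFe.aemeasurable]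
    _ = ∫⁻ ω, ∫⁻ n, F (evalRight (n, M t ω)) ∂(P.map fun ω s => N s ω) ∂P := by
        have := Measure.isProbabilityMeasure_map (μ := P) hNm.aemeasurable
        rw [lintegral_map hFe.lintegral_prod_left' (hM t)]
    _ = ∫⁻ ω, ∫⁻ ω', F (N (M t ω) ω') ∂P ∂P := by
        refine lintegral_congr fun ω => ?_
        rw [lintegral_map (f := fun n => F (evalRight (n, M t ω)))
          (hFe.comp measurable_prodMk_right) hNm]
        exact lintegral_congr_ae (hae.mono fun ω' hω' => by simp only [hω'])

lemma aemeasurable_timeChange (hβ : 0 < β) (hlam : 0 < lam)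
    (hN : IsFractionalPoissonProcess β lam N P) {M : ℝ≥0 → Ω → ℝ≥0} (hM : ∀ t, Measurable (M t))
    (t : ℝ≥0) : AEMeasurable (fun ω => (timeChange N M t ω : ℝ)) P := by
  have hNm : Measurable fun ω t => N t ω := measurable_pi_lambda _ hN.measurable
  refine ⟨fun ω => (evalRight (fun s => N s ω, M t ω)).toReal,
    (measurable_evalRight.comp (hNm.prodMk (hM t))).ennreal_toReal, ?_⟩
  filter_upwards [hN.ae_evalRight_eq hβ hlam] with ω hω
  rw [hω]
  simp [timeChange]

end IsFractionalPoissonProcess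

/-! ### Moments of the Mittag-Leffler process -/

/-- A tail estimate from the behaviour of the Laplace transform at `0` bounds the moments. -/
lemma integrable_rpow_of_laplace {Ω : Type*} [MeasurableSpace Ω] {P : Measure Ω}
    [IsProbabilityMeasure P] {X : Ω → ℝ} (hX : Measurable X) (hX0 : ∀ ω, 0 ≤ X ω) {a K p : ℝ}
    (hK : 0 ≤ K) (hp : 0 < p) (hpa : p < a)
    (hlap : ∀ u, 0 < u → 1 - K * u ^ a ≤ ∫ ω, Real.exp (-(u * X ω)) ∂P) :
    Integrable (fun ω => X ω ^ p) P := by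
  -- The value of 1 - exp(-ux) at u = 1/t, x = t: the threshold for Markov's inequality in `htail`.
  set e : ℝ := 1 - Real.exp (-1) with he
  have he0 : 0 < e := by rw [he, sub_pos, Real.exp_lt_one_iff]; norm_num
  have hexp : ∀ u, 0 < u → Integrable (fun ω => Real.exp (-(u * X ω))) P := fun u hu =>
    Integrable.of_bound (by fun_prop) 1 (.of_forall fun ω => by
      rw [Real.norm_of_nonneg (Real.exp_pos _).le, Real.exp_le_one_iff, neg_nonpos]
      exact mul_nonneg hu.le (hX0 ω))
  have htail : ∀ t, 0 < t → P {ω | t < X ω} ≤ ENNReal.ofReal (K / e * t ^ (-a)) := by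
    intro t ht
    have hsub : {ω | t < X ω} ⊆ {ω | e ≤ 1 - Real.exp (-(t⁻¹ * X ω))} := by
      intro ω (hω : t < X ω)
      change 1 - Real.exp (-1) ≤ 1 - Real.exp (-(t⁻¹ * X ω))
      have : 1 ≤ t⁻¹ * X ω := by
        rw [inv_mul_eq_div, one_le_div ht]; exact hω.le
      gcongr
    have hmk := mul_meas_ge_le_integral_of_nonneg (μ := P)
      (f := fun ω => 1 - Real.exp (-(t⁻¹ * X ω)))
      (.of_forall fun ω => by
        have : 0 ≤ t⁻¹ * X ω := mul_nonneg (by positivity) (hX0 ω)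
        simpa using this)
      ((integrable_const 1).sub (hexp _ (by positivity))) e
    rw [integral_sub (integrable_const 1) (hexp _ (by positivity))] at hmk
    simp only [integral_const, probReal_univ, smul_eq_mul, mul_one] at hmk
    have h1 := hlap t⁻¹ (by positivity)
    rw [← ofReal_measureReal]
    refine ENNReal.ofReal_le_ofReal ?_
    have h2 : P.real {ω | t < X ω} ≤ P.real {ω | e ≤ 1 - Real.exp (-(t⁻¹ * X ω))} :=
      measureReal_mono hsub
    rw [Real.inv_rpow ht.le, ← Real.rpow_neg ht.le] at h1
    rw [div_mul_eq_mul_div, le_div_iff₀ he0]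
    nlinarith
  refine ⟨(hX.pow_const p).aestronglyMeasurable, ?_⟩
  rw [hasFiniteIntegral_iff_ofReal (.of_forall fun ω => Real.rpow_nonneg (hX0 ω) _),
    lintegral_rpow_eq_lintegral_meas_lt_mul P (.of_forall hX0) hX.aemeasurable hp]
  refine ENNReal.mul_lt_top ENNReal.ofReal_lt_top ?_
  -- Near 0 the tail is at most 1 and p - 1 > -1; beyond 1 the tail bound gives exponent p - 1 - a <
  -- -1.
  rw [← Set.Ioc_union_Ioi_eq_Ioi (zero_le_one' ℝ),
    lintegral_union measurableSet_Ioi Set.Ioc_disjoint_Ioi_same]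
  refine ENNReal.add_lt_top.2 ⟨?_, ?_⟩
  · have hint : IntegrableOn (fun t : ℝ => t ^ (p - 1)) (Set.Ioc 0 1) :=
      (intervalIntegrable_iff_integrableOn_Ioc_of_le zero_le_one).1
        (intervalIntegral.intervalIntegrable_rpow' (by linarith))
    refine lt_of_le_of_lt (setLIntegral_mono (by fun_prop) fun t _ => ?_)
      hint.lintegral_lt_top
    exact mul_le_of_le_one_left' prob_le_one
  · have hint : IntegrableOn (fun t : ℝ => K / e * t ^ (p - 1 - a)) (Set.Ioi 1) :=
      (integrableOn_Ioi_rpow_of_lt (by linarith) one_pos).const_mul _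
    refine lt_of_le_of_lt (setLIntegral_mono (by fun_prop) fun t ht => ?_)
      hint.lintegral_lt_top
    have ht0 : (0 : ℝ) < t := one_pos.trans ht
    calc P {ω | t < X ω} * ENNReal.ofReal (t ^ (p - 1))
        ≤ ENNReal.ofReal (K / e * t ^ (-a)) * ENNReal.ofReal (t ^ (p - 1)) := by
          gcongr; exact htail t ht0
      _ = ENNReal.ofReal (K / e * t ^ (p - 1 - a)) := by
          rw [← ENNReal.ofReal_mul (by positivity), mul_assoc, ← Real.rpow_add ht0]
          ring_nf

/-- Combines log y ≤ y - 1 with 1 + z ≤ exp z. Used with x = u^α, c = ρt. -/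
lemma one_sub_le_rpow_div_add {μ x c : ℝ} (hμ : 0 < μ) (hx : 0 ≤ x) (hc : 0 ≤ c) :
    1 - c / μ * x ≤ (μ / (μ + x)) ^ c := by
  have hpos : 0 < μ / (μ + x) := by positivity
  have hlog : Real.log (μ / (μ + x)) = -Real.log ((μ + x) / μ) := by
    rw [← Real.log_inv, inv_div]
  have h1 := Real.log_le_sub_one_of_pos (show 0 < (μ + x) / μ by positivity)
  have h2 : (μ + x) / μ - 1 = x / μ := by field_simp; ring
  rw [h2] at h1
  rw [Real.rpow_def_of_pos hpos, hlog]
  have h3 := Real.add_one_le_exp (-Real.log ((μ + x) / μ) * c)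
  have h4 : Real.log ((μ + x) / μ) * c ≤ x / μ * c := by gcongr
  have h5 : c / μ * x = x / μ * c := by ring
  linarith

lemma IsMittagLefflerLevyProcess.integrable_rpow {Ω : Type*} [MeasurableSpace Ω] {P : Measure Ω}
    [IsProbabilityMeasure P] {α ρ μ : ℝ} (hρ : 0 < ρ) (hμ : 0 < μ)
    {M : ℝ≥0 → Ω → ℝ≥0} (hM : IsMittagLefflerLevyProcess α ρ μ M P) {p : ℝ} (hp : 0 < p)
    (hpα : p < α) (t : ℝ≥0) : Integrable (fun ω => (M t ω : ℝ) ^ p) P := by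
  refine integrable_rpow_of_laplace (K := ρ * t / μ) (a := α)
    (hM.measurable t).coe_nnreal_real (fun ω => (M t ω).coe_nonneg) (by positivity) hp hpα
    fun u hu => ?_
  rw [hM.laplace t u hu.le]
  exact one_sub_le_rpow_div_add hμ (by positivity) (by positivity)

/-- Otherwise M(t) = 0 almost surely and its Laplace transform at 1 would be 1, whereas
(μ/(μ+1))^(ρt) < 1. -/
lemma IsMittagLefflerLevyProcess.integral_rpow_pos {Ω : Type*} [MeasurableSpace Ω] {P : Measure Ω}
    [IsProbabilityMeasure P] {α ρ μ : ℝ} (hρ : 0 < ρ) (hμ : 0 < μ)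
    {M : ℝ≥0 → Ω → ℝ≥0} (hM : IsMittagLefflerLevyProcess α ρ μ M P) {p : ℝ} (hp : 0 < p)
    (hpα : p < α) {t : ℝ≥0} (ht : 0 < t) : 0 < ∫ ω, (M t ω : ℝ) ^ p ∂P := by
  refine lt_of_le_of_ne (integral_nonneg fun ω => by positivity) fun h => ?_
  have h0 := (integral_eq_zero_iff_of_nonneg (fun ω => by positivity)
    (hM.integrable_rpow hρ hμ hp hpα t)).1 h.symm
  have hl := hM.laplace t 1 zero_le_one
  have h1 : ∫ ω, Real.exp (-(1 * (M t ω : ℝ))) ∂P = ∫ ω, (1 : ℝ) ∂P := by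
    refine integral_congr_ae (h0.mono fun ω hω => ?_)
    have : (M t ω : ℝ) = 0 := (Real.rpow_eq_zero (M t ω).coe_nonneg hp.ne').1 hω
    simp [this]
  rw [h1, Real.one_rpow] at hl
  have ht' : (0 : ℝ) < t := ht
  have h2 : (μ / (μ + 1)) ^ (ρ * (t : ℝ)) < 1 :=
    Real.rpow_lt_one (by positivity) (by rw [div_lt_one (by positivity)]; linarith) (by positivity)
  simp at hl
  linarith

/-! ### Inequalities behind overdispersion -/

lemma sq_integral_le_integral_sq {Ω : Type*} [MeasurableSpace Ω] {P : Measure Ω}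
    [IsProbabilityMeasure P] {X : Ω → ℝ} (hX : MemLp X 2 P) :
    (∫ ω, X ω ∂P) ^ 2 ≤ ∫ ω, X ω ^ 2 ∂P := by
  have h := variance_nonneg X P
  rw [variance_eq_sub hX] at h
  simpa using h

lemma IsMittagLefflerLevyProcess.sq_integral_rpow_le {Ω : Type*} [MeasurableSpace Ω]
    {P : Measure Ω} [IsProbabilityMeasure P] {α ρ μ : ℝ} (hρ : 0 < ρ) (hμ : 0 < μ)
    {M : ℝ≥0 → Ω → ℝ≥0} (hM : IsMittagLefflerLevyProcess α ρ μ M P) {l : ℝ} (hl : 0 < l)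
    (hlα : l < α / 2) (t : ℝ≥0) :
    (∫ ω, (M t ω : ℝ) ^ l ∂P) ^ 2 ≤ ∫ ω, (M t ω : ℝ) ^ (2 * l) ∂P := by
  have hsq : ∀ ω, (M t ω : ℝ) ^ (2 * l) = ((M t ω : ℝ) ^ l) ^ 2 := fun ω => by
    rw [mul_comm, Real.rpow_mul (M t ω).coe_nonneg, Real.rpow_two]
  have h2 := hM.integrable_rpow hρ hμ (by positivity : 0 < 2 * l) (by linarith) t
  simp_rw [hsq] at h2 ⊢
  exact sq_integral_le_integral_sq ((memLp_two_iff_integrable_sq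
    ((hM.measurable t).coe_nnreal_real.pow_const l).aestronglyMeasurable).2 h2)

/-- Equivalent to B(β,β) > 1/β. Since (1-x)^(β-1) > 1 on (0, 1), the Beta integral exceeds that of
x^(β-1), which is 1/β. -/
lemma Real.Gamma_two_mul_lt {β : ℝ} (hβ : 0 < β) (hβ1 : β < 1) :
    Real.Gamma (2 * β) < β * Real.Gamma β ^ 2 := by
  have hb := beta_pos hβ hβ
  have h1 := lintegral_betaPDF_eq_one hβ hβ
  rw [lintegral_betaPDF] at h1
  have hint : IntegrableOn (fun x : ℝ => 1 / beta β β * x ^ (β - 1)) (Set.Ioo 0 1) :=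
    (((intervalIntegrable_iff_integrableOn_Ioc_of_le zero_le_one).1
      (intervalIntegral.intervalIntegrable_rpow' (by linarith))).mono_set
        Set.Ioo_subset_Ioc_self).const_mul _
  have hval : ∫⁻ x in Set.Ioo (0 : ℝ) 1, ENNReal.ofReal (1 / beta β β * x ^ (β - 1)) =
      ENNReal.ofReal (1 / beta β β * β⁻¹) := by
    rw [← ofReal_integral_eq_lintegral_ofReal hint, ← integral_Ioc_eq_integral_Ioo,
      ← intervalIntegral.integral_of_le zero_le_one, intervalIntegral.integral_const_mul,
      integral_rpow (.inl (by linarith))]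
    · simp [hβ.ne']
    · refine (ae_restrict_iff' measurableSet_Ioo).2 (.of_forall fun x hx => ?_)
      have := hx.1
      simp only [Pi.zero_apply]
      positivity
  have hlt : ENNReal.ofReal (1 / beta β β * β⁻¹) < 1 := by
    rw [← h1, ← hval]
    refine setLIntegral_strict_mono measurableSet_Ioo (by simp) (by fun_prop)
      (by rw [hval]; exact ENNReal.ofReal_ne_top) (.of_forall fun x hx => ?_)
    have hx0 := hx.1
    have hx1 : 0 < 1 - x := sub_pos.2 hx.2
    have h2 : 1 < (1 - x) ^ (β - 1) :=
      Real.one_lt_rpow_of_pos_of_lt_one_of_neg hx1 (by linarith) (by linarith)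
    have h3 : 0 < 1 / beta β β * x ^ (β - 1) := by positivity
    refine (ENNReal.ofReal_lt_ofReal_iff (by positivity)).2 ?_
    nlinarith
  rw [ENNReal.ofReal_lt_one] at hlt
  have hG : 0 < Real.Gamma (β + β) := Real.Gamma_pos_of_pos (by positivity)
  have hG1 : 0 < Real.Gamma β := Real.Gamma_pos_of_pos hβ
  rw [beta] at hlt
  have h4 : 1 / (Real.Gamma β * Real.Gamma β / Real.Gamma (β + β)) * β⁻¹ =
      Real.Gamma (2 * β) / (β * Real.Gamma β ^ 2) := by
    rw [two_mul]; field_simp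
  rwa [h4, div_lt_one (by positivity)] at hlt

/-! ### Moments of the time-changed process -/

lemma integrable_and_integral_of_lintegral_eq {Ω : Type*} [MeasurableSpace Ω] {P : Measure Ω}
    {X : Ω → ℝ} (hX : AEMeasurable X P) (hX0 : ∀ ω, 0 ≤ X ω) {a : ℝ} (ha : 0 ≤ a)
    (h : ∫⁻ ω, ENNReal.ofReal (X ω) ∂P = ENNReal.ofReal a) :
    Integrable X P ∧ ∫ ω, X ω ∂P = a := by
  refine ⟨⟨hX.aestronglyMeasurable, ?_⟩, ?_⟩
  · rw [hasFiniteIntegral_iff_ofReal (.of_forall hX0), h]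
    exact ENNReal.ofReal_lt_top
  · rw [integral_eq_lintegral_of_nonneg_ae (.of_forall hX0) hX.aestronglyMeasurable, h,
      ENNReal.toReal_ofReal ha]

namespace IsFractionalPoissonProcess

variable {Ω : Type*} [MeasurableSpace Ω] {P : Measure Ω} [IsProbabilityMeasure P] {β lam : ℝ}
  {N : ℝ≥0 → Ω → ℕ}

/-- The first two moments of a fractional Poisson process run by an independent clock. -/
lemma moments_timeChange (hβ : 0 < β) (hlam : 0 < lam)
    (hN : IsFractionalPoissonProcess β lam N P) {M : ℝ≥0 → Ω → ℝ≥0} (hM : ∀ t, Measurable (M t))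
    (hind : IndepFun (fun ω t => N t ω) (fun ω t => M t ω) P) (t : ℝ≥0)
    (h1 : Integrable (fun ω => (M t ω : ℝ) ^ β) P)
    (h2 : Integrable (fun ω => (M t ω : ℝ) ^ (2 * β)) P) :
    MemLp (fun ω => (timeChange N M t ω : ℝ)) 2 P ∧
    ∫ ω, (timeChange N M t ω : ℝ) ∂P = lam / Real.Gamma (β + 1) * ∫ ω, (M t ω : ℝ) ^ β ∂P ∧
    ∫ ω, (timeChange N M t ω : ℝ) ^ 2 ∂P =
      2 * lam ^ 2 / Real.Gamma (2 * β + 1) * ∫ ω, (M t ω : ℝ) ^ (2 * β) ∂P +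
        lam / Real.Gamma (β + 1) * ∫ ω, (M t ω : ℝ) ^ β ∂P := by
  have hG1 : 0 < Real.Gamma (β + 1) := Real.Gamma_pos_of_pos (by positivity)
  have hG2 : 0 < Real.Gamma (2 * β + 1) := Real.Gamma_pos_of_pos (by positivity)
  have hA : 0 ≤ ∫ ω, (M t ω : ℝ) ^ β ∂P := integral_nonneg fun ω => by positivity
  have hB : 0 ≤ ∫ ω, (M t ω : ℝ) ^ (2 * β) ∂P := integral_nonneg fun ω => by positivity
  have hm := hN.aemeasurable_timeChange hβ hlam hM t
  have e1 := hN.lintegral_timeChange hβ hlam hM hind t (F := fun x => x) measurable_id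
  have e2 := hN.lintegral_timeChange hβ hlam hM hind t (F := fun x => x ^ 2) (by fun_prop)
  simp only [(hN.lintegral_moments hβ hlam _).1] at e1
  simp only [(hN.lintegral_moments hβ hlam _).2] at e2
  have r1 : ∀ ω, lam * (M t ω : ℝ) ^ β / Real.Gamma (β + 1) =
      lam / Real.Gamma (β + 1) * (M t ω : ℝ) ^ β := fun ω => by ring
  have r2 : ∀ ω, 2 * (lam ^ 2 * (M t ω : ℝ) ^ (2 * β) / Real.Gamma (2 * β + 1)) =
      2 * lam ^ 2 / Real.Gamma (2 * β + 1) * (M t ω : ℝ) ^ (2 * β) := fun ω => by ring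
  simp only [r1] at e1
  simp only [r1, r2] at e2
  rw [← ofReal_integral_eq_lintegral_ofReal (h1.const_mul _) (.of_forall fun ω => by positivity),
    integral_const_mul] at e1
  rw [← ofReal_integral_eq_lintegral_ofReal
      (f := fun ω => 2 * lam ^ 2 / Real.Gamma (2 * β + 1) * (M t ω : ℝ) ^ (2 * β) +
        lam / Real.Gamma (β + 1) * (M t ω : ℝ) ^ β) ((h2.const_mul _).add (h1.const_mul _))
      (.of_forall fun ω => by positivity),
    integral_add (h2.const_mul _) (h1.const_mul _), integral_const_mul, integral_const_mul] at e2
  obtain ⟨-, i1⟩ := integrable_and_integral_of_lintegral_eq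
    (a := lam / Real.Gamma (β + 1) * ∫ ω, (M t ω : ℝ) ^ β ∂P) hm (fun ω => by positivity)
    (by positivity) (by simpa using e1)
  obtain ⟨i2, i2'⟩ := integrable_and_integral_of_lintegral_eq
    (a := 2 * lam ^ 2 / Real.Gamma (2 * β + 1) * ∫ ω, (M t ω : ℝ) ^ (2 * β) ∂P +
      lam / Real.Gamma (β + 1) * ∫ ω, (M t ω : ℝ) ^ β ∂P) (hm.pow_const 2) (fun ω => by positivity) (by positivity)
    (by simpa [ENNReal.ofReal_pow] using e2)
  exact ⟨(memLp_two_iff_integrable_sq hm.aestronglyMeasurable).2 i2, i1, i2'⟩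

end IsFractionalPoissonProcess

theorem lemmal1 {Ω : Type*} [MeasurableSpace Ω] (P : Measure Ω) [IsProbabilityMeasure P]
    (α ρ μ : ℝ) (hα : 0 < α) (hα1 : α < 1) (hρ : 0 < ρ) (hμ : 0 < μ)
    (M : ℝ≥0 → Ω → ℝ≥0) (hM : IsMittagLefflerLevyProcess α ρ μ M P) :
    (∀ l : ℝ, 0 < l → l < α / 2 → ∀ t : ℝ≥0,
      Integrable (fun ω => (M t ω : ℝ) ^ l) P ∧
      Integrable (fun ω => (M t ω : ℝ) ^ (2 * l)) P ∧
      (∫ ω, (M t ω : ℝ) ^ l ∂P) ^ 2 ≤ ∫ ω, (M t ω : ℝ) ^ (2 * l) ∂P) ∧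
    (∀ β lam : ℝ, 0 < β → β < α / 2 → 0 < lam →
      ∀ N : ℝ≥0 → Ω → ℕ, IsFractionalPoissonProcess β lam N P →
      IndepFun (fun ω t => N t ω) (fun ω t => M t ω) P →
      ∀ t : ℝ≥0,
        MemLp (fun ω => (timeChange N M t ω : ℝ)) 2 P ∧
        variance (fun ω => (timeChange N M t ω : ℝ)) P - ∫ ω, (timeChange N M t ω : ℝ) ∂P =
          lam ^ 2 / β * ((∫ ω, (M t ω : ℝ) ^ (2 * β) ∂P) / Real.Gamma (2 * β)
            - (∫ ω, (M t ω : ℝ) ^ β ∂P) ^ 2 / (β * Real.Gamma β ^ 2)) ∧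
        0 ≤ variance (fun ω => (timeChange N M t ω : ℝ)) P
          - ∫ ω, (timeChange N M t ω : ℝ) ∂P ∧
        (0 < t → 0 < variance (fun ω => (timeChange N M t ω : ℝ)) P
          - ∫ ω, (timeChange N M t ω : ℝ) ∂P)) := by
  refine ⟨fun l hl hlα t => ⟨hM.integrable_rpow hρ hμ hl (by linarith) t,
    hM.integrable_rpow hρ hμ (by positivity) (by linarith) t,
    hM.sq_integral_rpow_le hρ hμ hl hlα t⟩, ?_⟩
  intro β lam hβ hβα hlam N hN hind t
  obtain ⟨hmem, e1, e2⟩ := hN.moments_timeChange hβ hlam hM.measurable hind t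
    (hM.integrable_rpow hρ hμ hβ (by linarith) t)
    (hM.integrable_rpow hρ hμ (by positivity) (by linarith) t)
  have hG1 : 0 < Real.Gamma β := Real.Gamma_pos_of_pos hβ
  have hG2 : 0 < Real.Gamma (2 * β) := Real.Gamma_pos_of_pos (by positivity)
  have hle := hM.sq_integral_rpow_le hρ hμ hβ hβα t
  have hposA := fun ht => hM.integral_rpow_pos hρ hμ hβ (by linarith) (t := t) ht
  have hΓ := Real.Gamma_two_mul_lt hβ (by linarith)
  have hvar : variance (fun ω => (timeChange N M t ω : ℝ)) P - ∫ ω, (timeChange N M t ω : ℝ) ∂P =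
      lam ^ 2 / β * ((∫ ω, (M t ω : ℝ) ^ (2 * β) ∂P) / Real.Gamma (2 * β)
        - (∫ ω, (M t ω : ℝ) ^ β ∂P) ^ 2 / (β * Real.Gamma β ^ 2)) := by
    rw [variance_eq_sub hmem]
    simp only [Pi.pow_apply]
    rw [e1, e2, Real.Gamma_add_one hβ.ne', Real.Gamma_add_one (by positivity)]
    field_simp
    ring
  set A := ∫ ω, (M t ω : ℝ) ^ β ∂P
  set B := ∫ ω, (M t ω : ℝ) ^ (2 * β) ∂P
  -- A²/Γ(2β) separates the two terms: the moment inequality bounds it above by B/Γ(2β), and the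
  -- Gamma inequality bounds it below, strictly when A > 0.
  have hBA : A ^ 2 / Real.Gamma (2 * β) ≤ B / Real.Gamma (2 * β) := by gcongr
  refine ⟨hmem, hvar, ?_, fun ht => ?_⟩
  · rw [hvar]
    have : A ^ 2 / (β * Real.Gamma β ^ 2) ≤ A ^ 2 / Real.Gamma (2 * β) := by gcongr
    exact mul_nonneg (by positivity) (by linarith)
  · rw [hvar]
    have hA := hposA ht
    have : A ^ 2 / (β * Real.Gamma β ^ 2) < A ^ 2 / Real.Gamma (2 * β) := by gcongr
    exact mul_pos (by positivity) (by linarith)
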